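/- An element $a$ of a complex unital Banach algebra is called hermitian if $\|\exp(ita)\|=1$ for all $t\in\mathbb{R}$. A measure algebra $(\mathfrak{A},\mu)$ is a $\sigma$-complete Boolean algebra $\mathfrak{A}$ with a $\sigma$-additive map $\mu\colon\mathfrak{A}\to[0,\infty]$ such that $\mu(E)=0$ only for $E=0$; it is localizable if $\mathfrak{A}$ is a complete lattice and every $E\in\mathfrak{A}$ with $\mu(E)=\infty$ admits a nonzero $E'\leq E$ with $\mu(E')<\infty$. The spaces $L^p(\mathfrak{A},\mu)$ are those of a measure space whose measure algebra is $(\mathfrak{A},\mu)$, namely of the Stone space of $\mathfrak{A}$ with the $\sigma$-algebra generated by its clopen sets, where a set that differs from the clopen set of $E\in\mathfrak{A}$ by a meagre set has measure $\mu(E)$. All $L^p$-spaces are complex unless marked by the subscript $\mathbb{R}$. Let $p\in[1,\infty)\setminus\{2\}$. (1) Let $(\mathfrak{A},\mu)$ be a nonzero localizable measure algebra and let $a$ be a bounded operator on $L^p(\mathfrak{A},\mu)$. Then $a$ is hermitian (in the algebra of bounded operators) if and only if there exists $h\in L^\infty_{\mathbb{R}}(\mathfrak{A},\mu)$ such that $a$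 is the operator $f\mapsto hf$ of multiplication by $h$. The same holds for bounded operators on $L^p(X,\Sigma,\mu)$, with $h\in L^\infty_{\mathbb{R}}(X,\Sigma,\mu)$, whenever $(X,\Sigma,\mu)$ is a localizable measure space with $\mu\neq 0$, that is, $\mu$ is semi-finite and every family of measurable sets has an essential supremum. (2) Let $(X,\Sigma,\mu)$ be any measure space. If $a$ and $b$ are hermitian bounded operators on $L^p(X,\Sigma,\mu)$, then so is $ab$. -/

import Mathlib

open MeasureTheory Filter Topology
open scoped ENNReal

universe u v

noncomputable section

/-! ### Hermitian elements -/

/-- An element `a` of a complex unital Banach algebra is hermitian if `‖exp (i t a)‖ = 1` for all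
real `t`. -/
def IsHermitianElement {A : Type*} [NormedRing A] [NormedAlgebra ℂ A] (a : A) : Prop :=
  ∀ t : ℝ, ‖NormedSpace.exp ((Complex.I * (t : ℂ)) • a)‖ = 1

/-! ### Multiplication operators -/

/-- `a` is the operator on the complex space `L^p(μ)` of multiplication by `h ∈ L^∞_ℝ(μ)`. -/
def IsMultiplicationBy {X : Type*} [MeasurableSpace X] {μ : Measure X} {p : ℝ≥0∞} [Fact (1 ≤ p)]
    (a : Lp ℂ p μ →L[ℂ] Lp ℂ p μ) (h : Lp ℝ ∞ μ) : Prop :=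
  ∀ f : Lp ℂ p μ, (a f : X → ℂ) =ᵐ[μ] fun x => ((h x : ℝ) : ℂ) * f x

/-! ### Localizable measure spaces -/

/-- A measure is localizable if it is semi-finite and every family of measurable sets has an
essential supremum. -/
structure IsLocalizableMeasure {X : Type*} [MeasurableSpace X] (μ : Measure X) : Prop where
  semifinite : ∀ E : Set X, MeasurableSet E → μ E = ∞ →
    ∃ F ⊆ E, MeasurableSet F ∧ 0 < μ F ∧ μ F < ∞
  exists_essSup : ∀ S : Set (Set X), (∀ E ∈ S, MeasurableSet E) →
    ∃ H, MeasurableSet H ∧ (∀ E ∈ S, μ (E \ H) = 0) ∧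
      ∀ G, MeasurableSet G → (∀ E ∈ S, μ (E \ G) = 0) → μ (H \ G) = 0

/-! ### Measure algebras -/

/-- A measure algebra structure on the Boolean algebra `𝔄`: the algebra is `σ`-complete, and
`measure` is `σ`-additive and vanishes only at `⊥`. -/
structure MeasureAlgebra (𝔄 : Type*) [BooleanAlgebra 𝔄] where
  measure : 𝔄 → ℝ≥0∞
  exists_isLUB : ∀ f : ℕ → 𝔄, ∃ s, IsLUB (Set.range f) s
  measure_isLUB : ∀ f : ℕ → 𝔄, (∀ i j, i ≠ j → Disjoint (f i) (f j)) →
    ∀ s, IsLUB (Set.range f) s → measure s = ∑' n, measure (f n)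
  measure_eq_zero_iff : ∀ a, measure a = 0 ↔ a = ⊥

/-- A measure algebra is localizable if it is semi-finite and its Boolean algebra is a complete
lattice. -/
structure MeasureAlgebra.IsLocalizable {𝔄 : Type*} [BooleanAlgebra 𝔄] (M : MeasureAlgebra 𝔄) :
    Prop where
  semifinite : ∀ a, M.measure a = ∞ → ∃ b ≤ a, b ≠ ⊥ ∧ M.measure b < ∞
  complete : ∀ S : Set 𝔄, ∃ s, IsLUB S s

/-! ### The Stone space of a Boolean algebra -/

/-- The Stone space of `𝔄`: the set of Boolean homomorphisms from `𝔄` to the two-element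
algebra. -/
def StoneSpace (𝔄 : Type*) [BooleanAlgebra 𝔄] : Type _ :=
  {φ : 𝔄 → Bool // φ ⊤ = true ∧ (∀ a b, φ (a ⊓ b) = (φ a && φ b)) ∧ ∀ a, φ aᶜ = !φ a}

namespace StoneSpace

variable {𝔄 : Type*} [BooleanAlgebra 𝔄]

/-- The topology of pointwise convergence. -/
instance : TopologicalSpace (StoneSpace 𝔄) := instTopologicalSpaceSubtype

/-- The clopen subset of the Stone space that corresponds to `a ∈ 𝔄`. -/
def clopen (a : 𝔄) : Set (StoneSpace 𝔄) := {φ | φ.1 a = true}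

/-- The `σ`-algebra on the Stone space generated by the clopen sets. -/
instance : MeasurableSpace (StoneSpace 𝔄) := MeasurableSpace.generateFrom (Set.range clopen)

theorem clopen_top : clopen (⊤ : 𝔄) = Set.univ := by
  ext φ; simp [clopen, φ.2.1]

theorem clopen_inf (a b : 𝔄) : clopen (a ⊓ b) = clopen a ∩ clopen b := by
  ext φ; simp [clopen, φ.2.2.1]

theorem clopen_compl (a : 𝔄) : clopen aᶜ = (clopen a)ᶜ := by
  ext φ; simp [clopen, φ.2.2.2]

theorem clopen_bot : clopen (⊥ : 𝔄) = ∅ := by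
  rw [← compl_top, clopen_compl, clopen_top, Set.compl_univ]

theorem clopen_mono {a b : 𝔄} (h : a ≤ b) : clopen a ⊆ clopen b := by
  rw [← inf_eq_left.2 h, clopen_inf]; exact Set.inter_subset_right

theorem isClopen_clopen (a : 𝔄) : IsClopen (clopen a) :=
  (isClopen_discrete ({true} : Set Bool)).preimage
    ((continuous_apply a).comp continuous_subtype_val)

theorem measurableSet_clopen (a : 𝔄) : MeasurableSet (clopen a) :=
  MeasurableSpace.measurableSet_generateFrom ⟨a, rfl⟩

instance : CompactSpace (StoneSpace 𝔄) := by
  refine isCompact_iff_compactSpace.1 (IsClosed.isCompact (X := 𝔄 → Bool) ?_)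
  refine IsClosed.inter ?_ (IsClosed.inter ?_ ?_)
  · exact isClosed_eq (continuous_apply _) continuous_const
  · have : {φ : 𝔄 → Bool | ∀ a b, φ (a ⊓ b) = (φ a && φ b)} =
        ⋂ a, ⋂ b, {φ : 𝔄 → Bool | φ (a ⊓ b) = (φ a && φ b)} := by ext; simp
    change IsClosed {φ : 𝔄 → Bool | ∀ a b, φ (a ⊓ b) = (φ a && φ b)}
    rw [this]
    refine isClosed_iInter fun a => isClosed_iInter fun b => isClosed_eq
      (continuous_apply _) ?_
    have hand : Continuous fun x : Bool × Bool => x.1 && x.2 := continuous_of_discreteTopology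
    have hpair : Continuous fun φ : 𝔄 → Bool => (φ a, φ b) :=
      (continuous_apply a).prodMk (continuous_apply b)
    exact hand.comp hpair
  · have : {φ : 𝔄 → Bool | ∀ a, φ aᶜ = !φ a} = ⋂ a, {φ : 𝔄 → Bool | φ aᶜ = !φ a} := by
      ext; simp
    change IsClosed {φ : 𝔄 → Bool | ∀ a, φ aᶜ = !φ a}
    rw [this]
    refine isClosed_iInter fun a => isClosed_eq (continuous_apply _) ?_
    exact (continuous_of_discreteTopology (f := Bool.not)).comp (continuous_apply a)

instance : T2Space (StoneSpace 𝔄) :=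
  inferInstanceAs (T2Space (Subtype _))

theorem clopen_nonempty {a : 𝔄} (ha : a ≠ ⊥) : (clopen a).Nonempty := by
  classical
  obtain ⟨J, hJ, -, hd⟩ := DistribLattice.prime_ideal_of_disjoint_filter_ideal
    (F := Order.PFilter.principal a) (I := Order.Ideal.principal (⊥ : 𝔄)) (by
      rw [Set.disjoint_left]
      intro x hx hx'
      have h1 : a ≤ x := hx
      have h2 : x ≤ ⊥ := hx'
      exact ha (le_bot_iff.1 (h1.trans h2)))
  have haJ : a ∉ J := fun h => Set.disjoint_left.1 hd (show a ∈ Order.PFilter.principal a from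
    le_refl a) h
  have htop : (⊤ : 𝔄) ∉ J := fun h => haJ (J.lower le_top h)
  refine ⟨⟨fun x => decide (x ∉ J), by simpa using htop, fun x y => ?_, fun x => ?_⟩,
    decide_eq_true haJ⟩
  · rw [← Bool.decide_and, decide_eq_decide]
    refine ⟨fun h => ⟨fun hx => h (J.lower inf_le_left hx), fun hy => h (J.lower inf_le_right hy)⟩,
      fun h hxy => ?_⟩
    exact (hJ.mem_or_mem hxy).elim h.1 h.2
  · rw [← decide_not, decide_eq_decide, not_not]
    refine ⟨fun h => (hJ.mem_or_compl_mem).resolve_right h, fun h h' => htop ?_⟩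
    rw [← sup_compl_eq_top (x := x)]
    exact Order.Ideal.sup_mem h h'

theorem eq_of_residualEq {a b : 𝔄}
    (h : clopen a =ᶠ[residual (StoneSpace 𝔄)] clopen b) : a = b := by
  have key : ∀ c d : 𝔄, clopen c =ᶠ[residual (StoneSpace 𝔄)] clopen d → c ≤ d := by
    intro c d hcd
    by_contra hle
    have hne : c ⊓ dᶜ ≠ ⊥ := fun h0 => hle (by
      rwa [← disjoint_iff, disjoint_compl_right_iff] at h0)
    refine not_isMeagre_of_isOpen (isClopen_clopen (c ⊓ dᶜ)).isOpen (clopen_nonempty hne) ?_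
    rw [IsMeagre]
    filter_upwards [hcd.mem_iff] with φ hφ
    rw [clopen_inf, clopen_compl]
    exact fun h' => h'.2 (hφ.1 h'.1)
  exact le_antisymm (key a b h) (key b a h.symm)

/-- The clopen set of a countable supremum agrees with the union up to a meagre set. -/
theorem iUnion_clopen_residualEq {f : ℕ → 𝔄} {s : 𝔄} (hs : IsLUB (Set.range f) s) :
    (⋃ n, clopen (f n)) =ᶠ[residual (StoneSpace 𝔄)] clopen s := by
  have hopen : IsOpen (⋃ n, clopen (f n)) := isOpen_iUnion fun n => (isClopen_clopen _).isOpen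
  have hsub : (⋃ n, clopen (f n)) ⊆ clopen s :=
    Set.iUnion_subset fun n => clopen_mono (hs.1 ⟨n, rfl⟩)
  have hdense : Dense ((⋃ n, clopen (f n)) ∪ (clopen s)ᶜ) := by
    rw [dense_iff_inter_open]
    rintro U hU ⟨φ, hφ⟩
    by_contra hne
    rw [Set.not_nonempty_iff_eq_empty] at hne
    have hUs : U ⊆ clopen s := fun ψ hψ => by
      by_contra h
      exact (Set.eq_empty_iff_forall_notMem.1 hne ψ) ⟨hψ, Or.inr h⟩
    have hUf : ∀ n, Disjoint U (clopen (f n)) := fun n => Set.disjoint_left.2 fun ψ h1 h2 =>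
      (Set.eq_empty_iff_forall_notMem.1 hne ψ) ⟨h1, Or.inl (Set.mem_iUnion.2 ⟨n, h2⟩)⟩
    -- a basic clopen neighbourhood of `φ` inside `U`
    obtain ⟨c, hφc, hcU⟩ : ∃ c : 𝔄, φ ∈ clopen c ∧ clopen c ⊆ U := by
      obtain ⟨V, hV, rfl⟩ := isOpen_induced_iff.1 hU
      obtain ⟨I, u, hu, huV⟩ := isOpen_pi_iff.1 hV φ.1 hφ
      let g : 𝔄 → 𝔄 := fun a => if φ.1 a = true then a else aᶜ
      have hg : ∀ J : Finset 𝔄, clopen (J.inf g) = {ψ | ∀ a ∈ J, ψ.1 a = φ.1 a} := by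
        classical
        intro J
        induction J using Finset.induction_on with
        | empty => ext; simp [clopen_top]
        | insert a J haJ ih =>
          rw [Finset.inf_insert, clopen_inf, ih]
          ext ψ
          have : ψ ∈ clopen (g a) ↔ ψ.1 a = φ.1 a := by
            by_cases h : φ.1 a = true
            · simp [g, h, clopen]
            · simp [g, h, clopen_compl]; simp [clopen]
          simp [this]
      refine ⟨I.inf g, by rw [hg]; exact fun a _ => rfl, ?_⟩
      rw [hg]
      intro ψ hψ
      refine huV fun a ha => ?_
      rw [hψ a ha]
      exact (hu a ha).2
    have hle : s ≤ cᶜ := hs.2 (by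
      rintro _ ⟨n, rfl⟩
      rw [le_compl_iff_disjoint_right, disjoint_iff]
      by_contra h0
      obtain ⟨ψ, hψ⟩ := clopen_nonempty h0
      rw [clopen_inf] at hψ
      exact Set.disjoint_left.1 (hUf n) (hcU hψ.2) hψ.1)
    have := clopen_mono hle (hUs hφ)
    rw [clopen_compl] at this
    exact this hφc
  have := residual_of_dense_open (hopen.union (isClopen_clopen s).compl.isOpen) hdense
  filter_upwards [this] with φ hφ
  refine propext ⟨fun h => hsub h, fun h => hφ.resolve_right fun h' => h' h⟩

end StoneSpace

/-! ### The measure space and the `L^p`-space of a measure algebra -/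

namespace MeasureAlgebra

open StoneSpace

variable {𝔄 : Type*} [BooleanAlgebra 𝔄]

/-- Every set in the `σ`-algebra generated by the clopen sets agrees with a clopen set up to a
meagre set. -/
theorem exists_residualEq (M : MeasureAlgebra 𝔄) {E : Set (StoneSpace 𝔄)} (hE : MeasurableSet E) :
    ∃ a : 𝔄, E =ᶠ[residual (StoneSpace 𝔄)] clopen a := by
  induction E, hE using MeasurableSpace.generateFrom_induction with
  | hC t ht _ => obtain ⟨a, rfl⟩ := ht; exact ⟨a, EventuallyEq.rfl⟩
  | empty => exact ⟨⊥, by rw [clopen_bot]; exact EventuallyEq.rfl⟩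
  | compl t _ ih =>
    obtain ⟨a, ha⟩ := ih
    exact ⟨aᶜ, by rw [clopen_compl]; exact ha.compl⟩
  | iUnion f _ ih =>
    choose a ha using ih
    obtain ⟨s, hs⟩ := M.exists_isLUB a
    exact ⟨s, (Filter.EventuallyEq.countable_iUnion ha).trans (iUnion_clopen_residualEq hs)⟩

/-- The element of `𝔄` whose clopen set agrees with `E` up to a meagre set. -/
def elementOf (M : MeasureAlgebra 𝔄) (E : Set (StoneSpace 𝔄)) (hE : MeasurableSet E) : 𝔄 :=
  (M.exists_residualEq hE).choose

theorem elementOf_spec (M : MeasureAlgebra 𝔄) (E : Set (StoneSpace 𝔄)) (hE : MeasurableSet E) :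
    E =ᶠ[residual (StoneSpace 𝔄)] clopen (M.elementOf E hE) :=
  (M.exists_residualEq hE).choose_spec

theorem elementOf_eq (M : MeasureAlgebra 𝔄) {E : Set (StoneSpace 𝔄)} (hE : MeasurableSet E) {a : 𝔄}
    (h : E =ᶠ[residual (StoneSpace 𝔄)] clopen a) : M.elementOf E hE = a :=
  eq_of_residualEq ((M.elementOf_spec E hE).symm.trans h)

/-- The measure on the Stone space of `𝔄` that realizes the measure algebra: the measure of a set
that agrees with the clopen set of `a` up to a meagre set is the measure of `a`. -/
def stoneMeasure (M : MeasureAlgebra 𝔄) : Measure (StoneSpace 𝔄) :=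
  Measure.ofMeasurable (fun E hE => M.measure (M.elementOf E hE))
    (by
      rw [M.elementOf_eq MeasurableSet.empty (a := ⊥) (by rw [clopen_bot]; exact EventuallyEq.rfl),
        M.measure_eq_zero_iff])
    (by
      intro f hf hd
      obtain ⟨s, hs⟩ := M.exists_isLUB fun n => M.elementOf (f n) (hf n)
      have h1 : M.elementOf (⋃ i, f i) (MeasurableSet.iUnion hf) = s :=
        M.elementOf_eq _ ((Filter.EventuallyEq.countable_iUnion fun n => M.elementOf_spec (f n) (hf n)).trans
          (iUnion_clopen_residualEq hs))
      rw [h1]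
      refine M.measure_isLUB _ (fun i j hij => ?_) s hs
      rw [disjoint_iff]
      refine eq_of_residualEq ?_
      rw [clopen_inf, clopen_bot, ← Set.disjoint_iff_inter_eq_empty.1 (hd hij)]
      exact ((M.elementOf_spec (f i) (hf i)).inter (M.elementOf_spec (f j) (hf j))).symm)

theorem stoneMeasure_apply (M : MeasureAlgebra 𝔄) {E : Set (StoneSpace 𝔄)} (hE : MeasurableSet E) :
    M.stoneMeasure E = M.measure (M.elementOf E hE) :=
  Measure.ofMeasurable_apply E hE

theorem stoneMeasure_clopen (M : MeasureAlgebra 𝔄) (a : 𝔄) :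
    M.stoneMeasure (clopen a) = M.measure a := by
  rw [M.stoneMeasure_apply (measurableSet_clopen a), M.elementOf_eq _ EventuallyEq.rfl]

/-- The measure algebra of the Stone space is `𝔄`: modulo null sets, every measurable set is the
clopen set of exactly one element of `𝔄`. -/
theorem existsUnique_ae_eq_clopen (M : MeasureAlgebra 𝔄) {E : Set (StoneSpace 𝔄)}
    (hE : MeasurableSet E) : ∃! a : 𝔄, E =ᵐ[M.stoneMeasure] clopen a := by
  have null : ∀ F : Set (StoneSpace 𝔄), MeasurableSet F →
      (M.stoneMeasure F = 0 ↔ F =ᶠ[residual (StoneSpace 𝔄)] (∅ : Set (StoneSpace 𝔄))) := by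
    intro F hF
    rw [M.stoneMeasure_apply hF, M.measure_eq_zero_iff, ← clopen_bot]
    exact ⟨fun h => h ▸ M.elementOf_spec F hF, fun h => M.elementOf_eq hF h⟩
  have iff : ∀ a : 𝔄, E =ᵐ[M.stoneMeasure] clopen a ↔
      E =ᶠ[residual (StoneSpace 𝔄)] clopen a := by
    intro a
    rw [ae_eq_set, null _ (hE.diff (measurableSet_clopen a)),
      null _ ((measurableSet_clopen a).diff hE)]
    constructor
    · rintro ⟨h1, h2⟩
      filter_upwards [h1.mem_iff, h2.mem_iff] with φ h1 h2
      refine propext ⟨fun h => ?_, fun h => ?_⟩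
      · by_contra h'; exact h1.1 ⟨h, h'⟩
      · by_contra h'; exact h2.1 ⟨h, h'⟩
    · intro h
      constructor <;> filter_upwards [h.mem_iff] with φ h <;>
        refine propext ⟨fun h' => ?_, fun h' => h'.elim⟩
      · exact h'.2 (h.1 h'.1)
      · exact h'.2 (h.2 h'.1)
  refine ⟨M.elementOf E hE, (iff _).2 (M.elementOf_spec E hE), fun b hb => ?_⟩
  exact (M.elementOf_eq hE ((iff b).1 hb)).symm

/-- The complex space `L^p(𝔄, μ)` of a measure algebra. -/
abbrev Lp (M : MeasureAlgebra 𝔄) (p : ℝ≥0∞) := MeasureTheory.Lp ℂ p M.stoneMeasure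

/-- The real space `L^∞_ℝ(𝔄, μ)` of a measure algebra. -/
abbrev LinftyReal (M : MeasureAlgebra 𝔄) := MeasureTheory.Lp ℝ ∞ M.stoneMeasure

end MeasureAlgebra

end

/-! ### Clarkson's defect -/

/-! For `p ≠ 2` the defect in Clarkson's inequality has constant sign and vanishes exactly when `z *
w = 0`. Its integral depends only on norms in `L^p`, so isometries preserve disjointness of
supports.

If `a` is hermitian, each `exp (i t a)` is an isometry. Differentiating at `t = 0` shows that `a`
does not enlarge supports, hence commutes with multiplication by indicator functions. Norm bounds
then localize: `exp (i t a)` preserves `|f|` pointwise, and the first-order term of this identity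
makes `conj f * a f` real. Commuting with indicators also gives `f * a g = g * a f`, so the real
ratio `a f / f` does not depend on `f`.

On an arbitrary measure space these ratios need not glue to one function. The working notion is
therefore `IsLocallyRealMultiplication`: any two functions share a real multiplier. It is stable
under products. It also implies hermitian on a nonzero space, since `exp (i t a) f = exp (i t h) f`
pointwise. This gives closure under products for every measure.

If the measure is localizable, the multipliers `a 1_E` on sets of finite measure are glued by
essential suprema of their superlevel sets. Measure algebras reduce to this case through the Stone
space. -/

theorem Real.add_rpow_lt_rpow_add_rpow {x y r : ℝ} (hx : 0 < x) (hy : 0 < y) (hr : r < 1) :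
    (x + y) ^ r < x ^ r + y ^ r := by
  have hs : 0 < x + y := add_pos hx hy
  -- By homogeneity the sum may be normalized to `1`; a number in `(0, 1)` is smaller than its
  -- `r`-th power when `r < 1`.
  have h1 : x / (x + y) < (x / (x + y)) ^ r :=
    Real.self_lt_rpow_of_lt_one (div_pos hx hs) ((div_lt_one hs).2 (by linarith)) hr
  have h2 : y / (x + y) < (y / (x + y)) ^ r :=
    Real.self_lt_rpow_of_lt_one (div_pos hy hs) ((div_lt_one hs).2 (by linarith)) hr
  have h3 : x / (x + y) + y / (x + y) = 1 := by field_simp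
  rw [Real.div_rpow hx.le hs.le] at h1
  rw [Real.div_rpow hy.le hs.le] at h2
  have h4 : 1 < (x ^ r + y ^ r) / (x + y) ^ r := by rw [add_div]; linarith
  rwa [one_lt_div (Real.rpow_pos_of_pos hs r)] at h4

theorem Real.rpow_add_rpow_lt_add_rpow {x y r : ℝ} (hx : 0 < x) (hy : 0 < y) (hr : 1 < r) :
    x ^ r + y ^ r < (x + y) ^ r := by
  have hs : 0 < x + y := add_pos hx hy
  have h1 : (x / (x + y)) ^ r < x / (x + y) :=
    Real.rpow_lt_self_of_lt_one (div_pos hx hs) ((div_lt_one hs).2 (by linarith)) hr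
  have h2 : (y / (x + y)) ^ r < y / (x + y) :=
    Real.rpow_lt_self_of_lt_one (div_pos hy hs) ((div_lt_one hs).2 (by linarith)) hr
  have h3 : x / (x + y) + y / (x + y) = 1 := by field_simp
  rw [Real.div_rpow hx.le hs.le] at h1
  rw [Real.div_rpow hy.le hs.le] at h2
  have h4 : (x ^ r + y ^ r) / (x + y) ^ r < 1 := by rw [add_div]; linarith
  rwa [div_lt_one (Real.rpow_pos_of_pos hs r)] at h4

/-- The defect in Clarkson's inequality with exponent `p`. -/
noncomputable def clarksonDefect (p : ℝ) (z w : ℂ) : ℝ :=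
  2 * ‖z‖ ^ p + 2 * ‖w‖ ^ p - ‖z + w‖ ^ p - ‖z - w‖ ^ p

theorem clarksonDefect_eq (p : ℝ) (z w : ℂ) : clarksonDefect p z w =
    2 * (‖z‖ ^ 2) ^ (p / 2) + 2 * (‖w‖ ^ 2) ^ (p / 2) - (‖z + w‖ ^ 2) ^ (p / 2) -
      (‖z - w‖ ^ 2) ^ (p / 2) := by
  have key : ∀ x : ℂ, (‖x‖ ^ 2) ^ (p / 2) = ‖x‖ ^ p := fun x => by
    rw [← Real.rpow_natCast, ← Real.rpow_mul (norm_nonneg x)]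
    congr 1
    push_cast
    ring
  simp only [key, clarksonDefect]

/-- Concavity of `s ^ (p / 2)` and the parallelogram law bound the sum of the two subtracted terms
by `2 * (‖z‖ ^ 2 + ‖w‖ ^ 2) ^ (p / 2)`, and strict subadditivity of the same power finishes. For `p
> 2` every inequality reverses. -/
theorem clarksonDefect_pos {p : ℝ} (hp0 : 0 < p) (hp : p < 2) {z w : ℂ} (hz : z ≠ 0)
    (hw : w ≠ 0) : 0 < clarksonDefect p z w := by
  have h1 := Real.add_rpow_lt_rpow_add_rpow (pow_pos (norm_pos_iff.2 hz) 2)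
    (pow_pos (norm_pos_iff.2 hw) 2) (r := p / 2) (by linarith)
  have h2 := (Real.concaveOn_rpow (p := p / 2) (by linarith) (by linarith)).2
    (Set.mem_Ici.2 (sq_nonneg ‖z + w‖)) (Set.mem_Ici.2 (sq_nonneg ‖z - w‖))
    (by norm_num : (0 : ℝ) ≤ 1 / 2) (by norm_num : (0 : ℝ) ≤ 1 / 2) (by norm_num)
  have h3 := parallelogram_law_with_norm ℝ z w
  have h4 : (1 / 2 : ℝ) • ‖z + w‖ ^ 2 + (1 / 2 : ℝ) • ‖z - w‖ ^ 2 = ‖z‖ ^ 2 + ‖w‖ ^ 2 := by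
    simp only [smul_eq_mul]; linarith
  simp only [h4] at h2
  simp only [smul_eq_mul] at h2
  rw [clarksonDefect_eq]
  linarith

theorem clarksonDefect_neg {p : ℝ} (hp : 2 < p) {z w : ℂ} (hz : z ≠ 0)
    (hw : w ≠ 0) : clarksonDefect p z w < 0 := by
  have h1 := Real.rpow_add_rpow_lt_add_rpow (pow_pos (norm_pos_iff.2 hz) 2)
    (pow_pos (norm_pos_iff.2 hw) 2) (r := p / 2) (by linarith)
  have h2 := (convexOn_rpow (p := p / 2) (by linarith)).2
    (Set.mem_Ici.2 (sq_nonneg ‖z + w‖)) (Set.mem_Ici.2 (sq_nonneg ‖z - w‖))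
    (by norm_num : (0 : ℝ) ≤ 1 / 2) (by norm_num : (0 : ℝ) ≤ 1 / 2) (by norm_num)
  have h3 := parallelogram_law_with_norm ℝ z w
  have h4 : (1 / 2 : ℝ) • ‖z + w‖ ^ 2 + (1 / 2 : ℝ) • ‖z - w‖ ^ 2 = ‖z‖ ^ 2 + ‖w‖ ^ 2 := by
    simp only [smul_eq_mul]; linarith
  simp only [h4] at h2
  simp only [smul_eq_mul] at h2
  rw [clarksonDefect_eq]
  linarith

theorem clarksonDefect_eq_zero {p : ℝ} (hp0 : 0 < p) {z w : ℂ} (h : z * w = 0) :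
    clarksonDefect p z w = 0 := by
  rcases mul_eq_zero.1 h with rfl | rfl <;>
    simp [clarksonDefect, Real.zero_rpow hp0.ne'] <;> ring

theorem mul_eq_zero_of_clarksonDefect {p : ℝ} (hp0 : 0 < p) (hp2 : p ≠ 2) {z w : ℂ}
    (h : clarksonDefect p z w = 0) : z * w = 0 := by
  by_contra hzw
  rw [mul_eq_zero, not_or] at hzw
  rcases hp2.lt_or_gt with hp | hp
  · exact (clarksonDefect_pos hp0 hp hzw.1 hzw.2).ne' h
  · exact (clarksonDefect_neg hp hzw.1 hzw.2).ne h

theorem clarksonDefect_sign {p : ℝ} (hp0 : 0 < p) (hp2 : p ≠ 2) :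
    (∀ z w, 0 ≤ clarksonDefect p z w) ∨ ∀ z w, clarksonDefect p z w ≤ 0 := by
  rcases hp2.lt_or_gt with hp | hp
  · refine Or.inl fun z w => ?_
    by_cases h : z * w = 0
    · exact (clarksonDefect_eq_zero hp0 h).ge
    · rw [mul_eq_zero, not_or] at h
      exact (clarksonDefect_pos hp0 hp h.1 h.2).le
  · refine Or.inr fun z w => ?_
    by_cases h : z * w = 0
    · exact (clarksonDefect_eq_zero hp0 h).le
    · rw [mul_eq_zero, not_or] at h
      exact (clarksonDefect_neg hp h.1 h.2).le

/-! ### Isometries of `L^p` preserve disjointness -/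

theorem clarksonDefect_ae_eq {X : Type*} [MeasurableSpace X] {μ : Measure X} {p : ℝ≥0∞}
    (P : ℝ) (f g : Lp ℂ p μ) :
    (fun x => clarksonDefect P (f x) (g x)) =ᵐ[μ] fun x =>
      2 * ‖f x‖ ^ P + 2 * ‖g x‖ ^ P - ‖(f + g) x‖ ^ P - ‖(f - g) x‖ ^ P := by
  filter_upwards [Lp.coeFn_add f g, Lp.coeFn_sub f g] with x h1 h2
  rw [h1, h2]
  rfl

section Lp

variable {X : Type*} [MeasurableSpace X] {μ : Measure X} {p : ℝ≥0∞} [Fact (1 ≤ p)]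

theorem toReal_pos_of_fact_one_le (hp : p ≠ ∞) : 0 < p.toReal :=
  ENNReal.toReal_pos (zero_lt_one.trans_le Fact.out).ne' hp

theorem integrable_norm_rpow_Lp (hp : p ≠ ∞) (f : Lp ℂ p μ) :
    Integrable (fun x => ‖f x‖ ^ p.toReal) μ :=
  (Lp.memLp f).integrable_norm_rpow (zero_lt_one.trans_le Fact.out).ne' hp

theorem norm_rpow_eq_integral (hp : p ≠ ∞) (f : Lp ℂ p μ) :
    ‖f‖ ^ p.toReal = ∫ x, ‖f x‖ ^ p.toReal ∂μ := by
  have hn : 0 ≤ ∫ x, ‖f x‖ ^ p.toReal ∂μ :=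
    integral_nonneg fun x => Real.rpow_nonneg (norm_nonneg _) _
  rw [Lp.norm_def, (Lp.memLp f).eLpNorm_eq_integral_rpow_norm
    (zero_lt_one.trans_le Fact.out).ne' hp, ENNReal.toReal_ofReal (Real.rpow_nonneg hn _),
    Real.rpow_inv_rpow hn (toReal_pos_of_fact_one_le hp).ne']

theorem integrable_clarksonDefect (hp : p ≠ ∞) (f g : Lp ℂ p μ) :
    Integrable (fun x => clarksonDefect p.toReal (f x) (g x)) μ :=
  (((((integrable_norm_rpow_Lp hp f).const_mul 2).add
    ((integrable_norm_rpow_Lp hp g).const_mul 2)).sub (integrable_norm_rpow_Lp hp (f + g))).sub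
    (integrable_norm_rpow_Lp hp (f - g))).congr (clarksonDefect_ae_eq _ f g).symm

theorem integral_clarksonDefect (hp : p ≠ ∞) (f g : Lp ℂ p μ) :
    ∫ x, clarksonDefect p.toReal (f x) (g x) ∂μ =
      2 * ‖f‖ ^ p.toReal + 2 * ‖g‖ ^ p.toReal - ‖f + g‖ ^ p.toReal - ‖f - g‖ ^ p.toReal := by
  have i1 := (integrable_norm_rpow_Lp hp f).const_mul 2
  have i2 := (integrable_norm_rpow_Lp hp g).const_mul 2
  have i3 := integrable_norm_rpow_Lp hp (f + g)
  have i4 := integrable_norm_rpow_Lp hp (f - g)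
  rw [integral_congr_ae (clarksonDefect_ae_eq _ f g), integral_sub _ i4,
    integral_sub _ i3, integral_add i1 i2, integral_const_mul, integral_const_mul]
  · simp only [norm_rpow_eq_integral hp]
  · exact i1.add i2
  · exact (i1.add i2).sub i3

/-- The right side is the integral of the pointwise defect; as that has constant sign, the integral
vanishes only if the defect does almost everywhere. Disjointness thus becomes a condition on norms
alone. -/
theorem ae_mul_eq_zero_iff (hp : p ≠ ∞) (hp2 : p ≠ 2) (f g : Lp ℂ p μ) :
    (∀ᵐ x ∂μ, f x * g x = 0) ↔
      2 * ‖f‖ ^ p.toReal + 2 * ‖g‖ ^ p.toReal - ‖f + g‖ ^ p.toReal - ‖f - g‖ ^ p.toReal = 0 := by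
  have hp0 := toReal_pos_of_fact_one_le hp
  have hpr : p.toReal ≠ 2 := fun h => hp2 <| by
    rw [← ENNReal.ofReal_toReal hp, h]; simp
  have hi := integrable_clarksonDefect hp f g
  rw [← integral_clarksonDefect hp]
  constructor
  · intro h
    refine integral_eq_zero_of_ae ?_
    filter_upwards [h] with x hx using clarksonDefect_eq_zero hp0 hx
  · intro h
    have : (fun x => clarksonDefect p.toReal (f x) (g x)) =ᵐ[μ] 0 := by
      rcases clarksonDefect_sign hp0 hpr with hs | hs
      · exact (integral_eq_zero_iff_of_nonneg (fun x => hs _ _) hi).1 h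
      · have h' : ∫ x, -clarksonDefect p.toReal (f x) (g x) ∂μ = 0 := by
          rw [integral_neg, h, neg_zero]
        filter_upwards [(integral_eq_zero_iff_of_nonneg
          (fun x => neg_nonneg.2 (hs _ _)) hi.neg).1 h'] with x hx
        exact neg_eq_zero.1 hx
    filter_upwards [this] with x hx using mul_eq_zero_of_clarksonDefect hp0 hpr hx

/-- For `p ≠ 2` an isometry of `L^p` preserves disjointness of supports. -/
theorem ae_mul_eq_zero_of_isometry (hp : p ≠ ∞) (hp2 : p ≠ 2) {U : Lp ℂ p μ →L[ℂ] Lp ℂ p μ}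
    (hU : ∀ f, ‖U f‖ = ‖f‖) {f g : Lp ℂ p μ} (h : ∀ᵐ x ∂μ, f x * g x = 0) :
    ∀ᵐ x ∂μ, U f x * U g x = 0 := by
  rw [ae_mul_eq_zero_iff hp hp2] at h ⊢
  rw [← map_add, ← map_sub, hU, hU, hU, hU, h]

/-! ### Almost everywhere convergent subsequences -/

theorem exists_seq_tendsto_ae_Lp {F : ℕ → Lp ℂ p μ} {f : Lp ℂ p μ}
    (hF : Tendsto F atTop (𝓝 f)) :
    ∃ ns : ℕ → ℕ, StrictMono ns ∧ ∀ᵐ x ∂μ, Tendsto (fun n => F (ns n) x) atTop (𝓝 (f x)) :=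
  (tendstoInMeasure_of_tendsto_Lp hF).exists_seq_tendsto_ae

theorem exists_seq_tendsto_ae_Lp₂ {F G : ℕ → Lp ℂ p μ} {f g : Lp ℂ p μ}
    (hF : Tendsto F atTop (𝓝 f)) (hG : Tendsto G atTop (𝓝 g)) :
    ∃ ns : ℕ → ℕ, StrictMono ns ∧ ∀ᵐ x ∂μ, Tendsto (fun n => F (ns n) x) atTop (𝓝 (f x)) ∧
      Tendsto (fun n => G (ns n) x) atTop (𝓝 (g x)) := by
  obtain ⟨n, hn, h⟩ := exists_seq_tendsto_ae_Lp hF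
  -- The second subsequence is extracted from the first, so that one sequence serves both limits.
  obtain ⟨m, hm, h'⟩ := exists_seq_tendsto_ae_Lp (hG.comp hn.tendsto_atTop)
  refine ⟨n ∘ m, hn.comp hm, ?_⟩
  filter_upwards [h, h'] with x hx hx'
  exact ⟨hx.comp hm.tendsto_atTop, hx'⟩

end Lp

/-! ### The unitary group of a hermitian element -/

section Exp

variable {A : Type*} [NormedRing A] [NormedAlgebra ℂ A]

/-- The one-parameter group `exp (i t a)`. -/
noncomputable def expI (a : A) (t : ℝ) : A := NormedSpace.exp ((Complex.I * (t : ℂ)) • a)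

theorem commute_expI {a b : A} (h : Commute a b) (t : ℝ) : Commute (expI a t) b := by
  let _ : NormedAlgebra ℚ A := NormedAlgebra.restrictScalars ℚ ℂ A
  exact (h.smul_left _).exp_left

theorem IsHermitianElement.norm_expI {a : A} (ha : IsHermitianElement a) (t : ℝ) :
    ‖expI a t‖ = 1 := ha t

variable [CompleteSpace A]

theorem expI_neg_mul (a : A) (t : ℝ) : expI a (-t) * expI a t = 1 := by
  let _ : NormedAlgebra ℚ A := NormedAlgebra.restrictScalars ℚ ℂ A
  rw [expI, expI,
    ← NormedSpace.exp_add_of_commute (((Commute.refl a).smul_left _).smul_right _), ← add_smul]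
  simp

/-- The derivative of the group at `0` recovers `a`; a sequence of times is used because almost
everywhere convergence is available only along sequences. -/
theorem tendsto_expI_slope (a : A) : Tendsto
    (fun n : ℕ => (Complex.I * ((1 / ((n : ℝ) + 1) : ℝ) : ℂ))⁻¹ •
      (expI a (1 / ((n : ℝ) + 1)) - 1)) atTop (𝓝 a) := by
  have h := hasDerivAt_exp_smul_const (𝕂 := ℂ) a 0
  simp only [zero_smul, NormedSpace.exp_zero, one_mul] at h
  have hu : Tendsto (fun n : ℕ => Complex.I * ((1 / ((n : ℝ) + 1) : ℝ) : ℂ)) atTop (𝓝[≠] 0) := by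
    refine tendsto_nhdsWithin_iff.2 ⟨?_, Eventually.of_forall fun n => ?_⟩
    · have := (Complex.continuous_ofReal.tendsto _).comp
        (tendsto_one_div_add_atTop_nhds_zero_nat (𝕜 := ℝ))
      simpa using this.const_mul Complex.I
    · refine mul_ne_zero Complex.I_ne_zero (Complex.ofReal_ne_zero.2 ?_)
      positivity
  refine (h.tendsto_slope_zero.comp hu).congr fun n => ?_
  simp [expI]

theorem tendsto_expI_one (a : A) : Tendsto
    (fun n : ℕ => expI a (1 / ((n : ℝ) + 1))) atTop (𝓝 1) := by
  have h := (hasDerivAt_exp_smul_const (𝕂 := ℂ) a 0).continuousAt.tendsto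
  simp only [zero_smul, NormedSpace.exp_zero] at h
  refine h.comp ?_
  have := (Complex.continuous_ofReal.tendsto _).comp
    (tendsto_one_div_add_atTop_nhds_zero_nat (𝕜 := ℝ))
  simpa using this.const_mul Complex.I

end Exp

theorem IsHermitianElement.norm_expI_apply {E : Type*} [NormedAddCommGroup E] [NormedSpace ℂ E]
    [CompleteSpace E] {a : E →L[ℂ] E} (ha : IsHermitianElement a) (t : ℝ) (f : E) :
    ‖expI a t f‖ = ‖f‖ := by
  refine le_antisymm ?_ ?_
  · simpa [ha.norm_expI t] using (expI a t).le_opNorm f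
  -- The inverse `expI a (-t)` is a contraction too.
  · have h := (expI a (-t)).le_opNorm (expI a t f)
    have h' : expI a (-t) (expI a t f) = f := DFunLike.congr_fun (expI_neg_mul a t) f
    rwa [ha.norm_expI, one_mul, h'] at h

/-! ### Restriction to measurable sets -/

section Lp

variable {X : Type*} [MeasurableSpace X] {μ : Measure X} {p : ℝ≥0∞}

/-- The product of an `L^p` function with the indicator function of `s`. -/
noncomputable def indicatorLp {s : Set X} (hs : MeasurableSet s) (f : Lp ℂ p μ) : Lp ℂ p μ :=
  MemLp.toLp (s.indicator (f : X → ℂ)) ((Lp.memLp f).indicator hs)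

theorem coeFn_indicatorLp {s : Set X} (hs : MeasurableSet s) (f : Lp ℂ p μ) :
    indicatorLp hs f =ᵐ[μ] s.indicator (f : X → ℂ) := by
  unfold indicatorLp
  exact MemLp.coeFn_toLp _

theorem indicatorLp_add {s : Set X} (hs : MeasurableSet s) (f g : Lp ℂ p μ) :
    indicatorLp hs (f + g) = indicatorLp hs f + indicatorLp hs g := by
  ext1
  filter_upwards [coeFn_indicatorLp hs (f + g), coeFn_indicatorLp hs f, coeFn_indicatorLp hs g,
    Lp.coeFn_add f g, Lp.coeFn_add (indicatorLp hs f) (indicatorLp hs g)] with x h1 h2 h3 h4 h5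
  rw [h1, h5, Pi.add_apply, h2, h3]
  by_cases hx : x ∈ s
  · rw [Set.indicator_of_mem hx, Set.indicator_of_mem hx, Set.indicator_of_mem hx, h4]
    rfl
  · simp [hx]

theorem indicatorLp_smul {s : Set X} (hs : MeasurableSet s) (c : ℂ) (f : Lp ℂ p μ) :
    indicatorLp hs (c • f) = c • indicatorLp hs f := by
  ext1
  filter_upwards [coeFn_indicatorLp hs (c • f), coeFn_indicatorLp hs f, Lp.coeFn_smul c f,
    Lp.coeFn_smul c (indicatorLp hs f)] with x h1 h2 h3 h4
  rw [h1, h4, Pi.smul_apply, h2]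
  by_cases hx : x ∈ s <;> simp [hx, h3]

theorem norm_indicatorLp_le {s : Set X} (hs : MeasurableSet s) (f : Lp ℂ p μ) :
    ‖indicatorLp hs f‖ ≤ 1 * ‖f‖ := by
  rw [one_mul]
  refine Lp.norm_le_norm_of_ae_le ?_
  filter_upwards [coeFn_indicatorLp hs f] with x h1
  exact (congrArg norm h1).trans_le (norm_indicator_le_norm_self _ _)

variable [Fact (1 ≤ p)]

variable (μ p) in
/-- Multiplication by the indicator function of `s` on `L^p`. -/
noncomputable def restrictLp {s : Set X} (hs : MeasurableSet s) : Lp ℂ p μ →L[ℂ] Lp ℂ p μ :=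
  LinearMap.mkContinuous
    ({ toFun := indicatorLp hs
       map_add' := indicatorLp_add hs
       map_smul' := indicatorLp_smul hs } : Lp ℂ p μ →ₗ[ℂ] Lp ℂ p μ)
    1 (norm_indicatorLp_le hs)

theorem coeFn_restrictLp {s : Set X} (hs : MeasurableSet s) (f : Lp ℂ p μ) :
    restrictLp μ p hs f =ᵐ[μ] s.indicator (f : X → ℂ) :=
  coeFn_indicatorLp hs f

theorem restrictLp_add_compl {s : Set X} (hs : MeasurableSet s) (f : Lp ℂ p μ) :
    restrictLp μ p hs f + restrictLp μ p hs.compl f = f := by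
  ext1
  filter_upwards [Lp.coeFn_add (restrictLp μ p hs f) (restrictLp μ p hs.compl f),
    coeFn_restrictLp hs f, coeFn_restrictLp hs.compl f] with x h1 h2 h3
  rw [h1, Pi.add_apply, h2, h3]
  by_cases hx : x ∈ s <;> simp [hx]

theorem norm_restrictLp_rpow (hp : p ≠ ∞) {s : Set X} (hs : MeasurableSet s) (f : Lp ℂ p μ) :
    ‖restrictLp μ p hs f‖ ^ p.toReal = ∫ x in s, ‖f x‖ ^ p.toReal ∂μ := by
  rw [norm_rpow_eq_integral hp, ← integral_indicator hs]
  refine integral_congr_ae ?_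
  filter_upwards [coeFn_restrictLp hs f] with x hx
  rw [hx]
  by_cases hx : x ∈ s <;> simp [hx, Real.zero_rpow (toReal_pos_of_fact_one_le hp).ne']

/-- An operator that does not enlarge supports commutes with restrictions. -/
theorem restrictLp_comm_of_local {a : Lp ℂ p μ →L[ℂ] Lp ℂ p μ}
    (ha : ∀ f g : Lp ℂ p μ, (∀ᵐ x ∂μ, f x * g x = 0) → ∀ᵐ x ∂μ, a f x * g x = 0)
    {s : Set X} (hs : MeasurableSet s) : Commute a (restrictLp μ p hs) := by
  have key : ∀ {s : Set X} (hs : MeasurableSet s) (f : Lp ℂ p μ),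
      ∀ᵐ x ∂μ, x ∉ s → a (restrictLp μ p hs f) x = 0 := by
    intro s hs f
    -- The test function is the part of the image lying off `s`; locality makes its square vanish.
    have h := ha (restrictLp μ p hs f) (restrictLp μ p hs.compl (a (restrictLp μ p hs f))) (by
      filter_upwards [coeFn_restrictLp hs f,
        coeFn_restrictLp hs.compl (a (restrictLp μ p hs f))] with x h1 h2
      rw [h1, h2]
      by_cases hx : x ∈ s <;> simp [hx])
    filter_upwards [h, coeFn_restrictLp hs.compl (a (restrictLp μ p hs f))] with x h1 h2 hx
    rw [h2] at h1
    simpa [hx] using h1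
  refine ContinuousLinearMap.ext fun f => ?_
  change a (restrictLp μ p hs f) = restrictLp μ p hs (a f)
  ext1
  have hsum := Lp.coeFn_add (a (restrictLp μ p hs f)) (a (restrictLp μ p hs.compl f))
  rw [← map_add, restrictLp_add_compl hs f] at hsum
  filter_upwards [key hs f, key hs.compl f, coeFn_restrictLp hs (a f), hsum] with x h1 h2 h3 h4
  rw [h3]
  by_cases hx : x ∈ s
  · simp [hx, h4, h2]
  · simp [hx, h1]

/-- An operator that commutes with restrictions satisfies its norm bound pointwise. -/
theorem ae_norm_apply_le (hp : p ≠ ∞) {a : Lp ℂ p μ →L[ℂ] Lp ℂ p μ}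
    (ha : ∀ {s : Set X} (hs : MeasurableSet s), Commute a (restrictLp μ p hs))
    {C : ℝ} (hC : 0 ≤ C) (hb : ∀ f, ‖a f‖ ≤ C * ‖f‖) (f : Lp ℂ p μ) :
    ∀ᵐ x ∂μ, ‖a f x‖ ≤ C * ‖f x‖ := by
  have hp0 := toReal_pos_of_fact_one_le hp
  -- The norm bound applied to the restriction of `f` to `s` compares the integrals of the `p`-th
  -- powers over every `s`.
  have h := ae_le_of_forall_setIntegral_le (integrable_norm_rpow_Lp hp (a f))
    ((integrable_norm_rpow_Lp hp f).const_mul (C ^ p.toReal)) (fun s hs _ => by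
      rw [integral_const_mul, ← norm_restrictLp_rpow hp hs, ← norm_restrictLp_rpow hp hs,
        ← Real.mul_rpow hC (norm_nonneg _)]
      refine Real.rpow_le_rpow (norm_nonneg _) ?_ hp0.le
      have : restrictLp μ p hs (a f) = a (restrictLp μ p hs f) :=
        (DFunLike.congr_fun (ha hs) f).symm
      rw [this]
      exact hb _)
  filter_upwards [h] with x hx
  rw [← Real.mul_rpow hC (norm_nonneg _)] at hx
  exact (Real.rpow_le_rpow_iff (norm_nonneg _) (mul_nonneg hC (norm_nonneg _)) hp0).1 hx

/-- An operator that commutes with restrictions is given by a pointwise ratio. -/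
theorem ae_mul_apply_comm (hp : p ≠ ∞) {a : Lp ℂ p μ →L[ℂ] Lp ℂ p μ}
    (ha : ∀ {s : Set X} (hs : MeasurableSet s), Commute a (restrictLp μ p hs)) (f g : Lp ℂ p μ) :
    ∀ᵐ x ∂μ, f x * a g x = g x * a f x := by
  have hclosed : ∀ g : Lp ℂ p μ, IsClosed {f : Lp ℂ p μ | ∀ᵐ x ∂μ, f x * a g x = g x * a f x} := by
    intro g
    refine IsSeqClosed.isClosed fun F f hF hf => ?_
    obtain ⟨ns, -, hns⟩ := exists_seq_tendsto_ae_Lp₂ hf ((a.continuous.tendsto f).comp hf)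
    have hF' : ∀ᵐ x ∂μ, ∀ n, F n x * a g x = g x * a (F n) x := ae_all_iff.2 hF
    filter_upwards [hns, hF'] with x h1 h2
    refine tendsto_nhds_unique (h1.1.mul_const _) ((h1.2.const_mul _).congr fun n => ?_)
    exact (h2 _).symm
  have hadd : ∀ g f₁ f₂ : Lp ℂ p μ, (∀ᵐ x ∂μ, f₁ x * a g x = g x * a f₁ x) →
      (∀ᵐ x ∂μ, f₂ x * a g x = g x * a f₂ x) →
      ∀ᵐ x ∂μ, (f₁ + f₂ : Lp ℂ p μ) x * a g x = g x * a (f₁ + f₂) x := by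
    intro g f₁ f₂ h₁ h₂
    rw [map_add]
    filter_upwards [h₁, h₂, Lp.coeFn_add f₁ f₂, Lp.coeFn_add (a f₁) (a f₂)] with x h1 h2 h3 h4
    rw [h3, h4, Pi.add_apply, Pi.add_apply, add_mul, mul_add, h1, h2]
  have hind : ∀ (c d : ℂ) {s t : Set X} (hs : MeasurableSet s) (hμs : μ s ≠ ∞)
      (ht : MeasurableSet t) (hμt : μ t ≠ ∞), ∀ᵐ x ∂μ,
      indicatorConstLp p hs hμs c x * a (indicatorConstLp p ht hμt d) x =
        indicatorConstLp p ht hμt d x * a (indicatorConstLp p hs hμs c) x := by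
    intro c d s t hs hμs ht hμt
    -- Both sides are `c * d` times the indicator of `s ∩ t`; applying `a` and moving it past the
    -- restrictions gives the claim.
    have hr : d • restrictLp μ p ht (indicatorConstLp p hs hμs c) =
        c • restrictLp μ p hs (indicatorConstLp p ht hμt d) := by
      ext1
      filter_upwards [Lp.coeFn_smul d (restrictLp μ p ht (indicatorConstLp p hs hμs c)),
        Lp.coeFn_smul c (restrictLp μ p hs (indicatorConstLp p ht hμt d)),
        coeFn_restrictLp ht (indicatorConstLp p hs hμs c),
        coeFn_restrictLp hs (indicatorConstLp p ht hμt d),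
        indicatorConstLp_coeFn (p := p) (hs := hs) (hμs := hμs) (c := c),
        indicatorConstLp_coeFn (p := p) (hs := ht) (hμs := hμt) (c := d)] with x h1 h2 h3 h4 h5 h6
      rw [h1, h2, Pi.smul_apply, Pi.smul_apply, h3, h4]
      by_cases hx : x ∈ s <;> by_cases hx' : x ∈ t <;> simp [hx, hx', h5, h6, mul_comm]
    have hcomm : ∀ {s : Set X} (hs : MeasurableSet s) (f : Lp ℂ p μ),
        a (restrictLp μ p hs f) = restrictLp μ p hs (a f) := fun hs f =>
      DFunLike.congr_fun (ha hs) f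
    have hr' : d • restrictLp μ p ht (a (indicatorConstLp p hs hμs c)) =
        c • restrictLp μ p hs (a (indicatorConstLp p ht hμt d)) := by
      have := congrArg a hr
      rw [map_smul, map_smul] at this
      rwa [hcomm, hcomm] at this
    have e1 := Lp.coeFn_smul d (restrictLp μ p ht (a (indicatorConstLp p hs hμs c)))
    rw [hr'] at e1
    filter_upwards [e1,
      Lp.coeFn_smul c (restrictLp μ p hs (a (indicatorConstLp p ht hμt d))),
      coeFn_restrictLp ht (a (indicatorConstLp p hs hμs c)),
      coeFn_restrictLp hs (a (indicatorConstLp p ht hμt d)),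
      indicatorConstLp_coeFn (p := p) (hs := hs) (hμs := hμs) (c := c),
      indicatorConstLp_coeFn (p := p) (hs := ht) (hμs := hμt) (c := d)] with x h1 h2 h3 h4 h5 h6
    rw [h1, Pi.smul_apply, Pi.smul_apply, h3, h4] at h2
    rw [h5, h6]
    by_cases hx : x ∈ s <;> by_cases hx' : x ∈ t <;> simp_all
  induction f using Lp.induction hp with
  | indicatorConst c hs hμs =>
    induction g using Lp.induction hp with
    | indicatorConst d ht hμt => exact hind c d hs hμs.ne ht hμt.ne
    | @add f g hf hg hd h1 h2 =>
      filter_upwards [hadd _ _ _ (h1.mono fun x h => h.symm) (h2.mono fun x h => h.symm)]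
        with x h using h.symm
    | isClosed => simpa only [eq_comm] using hclosed _
  | @add f g hf hg hd h1 h2 => exact hadd _ _ _ h1 h2
  | isClosed => exact hclosed g

end Lp

section Lp

variable {X : Type*} [MeasurableSpace X] {μ : Measure X} {p : ℝ≥0∞} [Fact (1 ≤ p)]

/-! ### Hermitian operators are local multiplications by real functions -/

/-- Near `t = 0`, `exp (i t a) f = f + i t d` with `d → a f`, along a sequence of `t`. -/
theorem exists_expI_expansion (a : Lp ℂ p μ →L[ℂ] Lp ℂ p μ) (f g : Lp ℂ p μ) :
    ∃ (t : ℕ → ℝ) (d : ℕ → X → ℂ), (∀ n, t n ≠ 0) ∧ Tendsto t atTop (𝓝 0) ∧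
      ∀ᵐ x ∂μ, (∀ n, expI a (t n) f x = f x + Complex.I * t n * d n x) ∧
        Tendsto (fun n => d n x) atTop (𝓝 (a f x)) ∧
        Tendsto (fun n => expI a (t n) g x) atTop (𝓝 (g x)) := by
  have h1 := ((ContinuousLinearMap.apply ℂ (Lp ℂ p μ) f).continuous.tendsto _).comp
    (tendsto_expI_slope a)
  have h2 := ((ContinuousLinearMap.apply ℂ (Lp ℂ p μ) g).continuous.tendsto _).comp
    (tendsto_expI_one a)
  obtain ⟨ns, hns, h⟩ := exists_seq_tendsto_ae_Lp₂ h1 h2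
  have ht : ∀ n : ℕ, 1 / ((n : ℝ) + 1) ≠ 0 := fun n => by positivity
  have hd : ∀ n : ℕ, ∀ᵐ x ∂μ, expI a (1 / ((n : ℝ) + 1)) f x =
      f x + Complex.I * ((1 / ((n : ℝ) + 1) : ℝ) : ℂ) *
        ((Complex.I * ((1 / ((n : ℝ) + 1) : ℝ) : ℂ))⁻¹ •
          (expI a (1 / ((n : ℝ) + 1)) f - f) : Lp ℂ p μ) x := by
    intro n
    filter_upwards [Lp.coeFn_smul (Complex.I * ((1 / ((n : ℝ) + 1) : ℝ) : ℂ))⁻¹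
      (expI a (1 / ((n : ℝ) + 1)) f - f), Lp.coeFn_sub (expI a (1 / ((n : ℝ) + 1)) f) f]
      with x h3 h4
    rw [h3, Pi.smul_apply, h4, smul_eq_mul, mul_inv_cancel_left₀
      (mul_ne_zero Complex.I_ne_zero (Complex.ofReal_ne_zero.2 (ht n)))]
    simp
  refine ⟨fun n => 1 / ((ns n : ℝ) + 1), fun n x =>
    ((Complex.I * ((1 / ((ns n : ℝ) + 1) : ℝ) : ℂ))⁻¹ •
          (expI a (1 / ((ns n : ℝ) + 1)) f - f) : Lp ℂ p μ) x, fun n => ht _,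
    (tendsto_one_div_add_atTop_nhds_zero_nat (𝕜 := ℝ)).comp hns.tendsto_atTop, ?_⟩
  filter_upwards [h, ae_all_iff.2 hd] with x h5 h6
  exact ⟨fun n => h6 _, h5⟩

/-- Where `f` vanishes, `exp (i t a) f` equals `i t d`, so preservation of disjointness gives `d *
exp (i t a) g = 0`, with limit `a f * g = 0`. -/
theorem IsHermitianElement.ae_mul_eq_zero (hp : p ≠ ∞) (hp2 : p ≠ 2)
    {a : Lp ℂ p μ →L[ℂ] Lp ℂ p μ} (ha : IsHermitianElement a) (f g : Lp ℂ p μ)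
    (h : ∀ᵐ x ∂μ, f x * g x = 0) : ∀ᵐ x ∂μ, a f x * g x = 0 := by
  obtain ⟨t, d, ht, -, hd⟩ := exists_expI_expansion a f g
  have h0 : ∀ᵐ x ∂μ, ∀ n, expI a (t n) f x * expI a (t n) g x = 0 :=
    ae_all_iff.2 fun n => ae_mul_eq_zero_of_isometry hp hp2 (ha.norm_expI_apply (t n)) h
  filter_upwards [h, hd, h0] with x h1 ⟨h2, h3, h4⟩ h5
  rcases mul_eq_zero.1 h1 with hf | hg
  · refine tendsto_nhds_unique (h3.mul h4) (tendsto_const_nhds.congr fun n => ?_)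
    have h6 := h5 n
    rw [h2, hf, zero_add, mul_assoc] at h6
    exact ((mul_eq_zero.1 h6).resolve_left
      (mul_ne_zero Complex.I_ne_zero (Complex.ofReal_ne_zero.2 (ht n)))).symm
  · rw [hg, mul_zero]

theorem IsHermitianElement.commute_restrictLp (hp : p ≠ ∞) (hp2 : p ≠ 2)
    {a : Lp ℂ p μ →L[ℂ] Lp ℂ p μ} (ha : IsHermitianElement a) {s : Set X} (hs : MeasurableSet s) :
    Commute a (restrictLp μ p hs) :=
  restrictLp_comm_of_local (ha.ae_mul_eq_zero hp hp2) hs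

/-- The exponentials inherit commutation with restrictions, so both `exp (i t a)` and its inverse
are pointwise contractions. -/
theorem IsHermitianElement.ae_norm_expI_apply (hp : p ≠ ∞) (hp2 : p ≠ 2)
    {a : Lp ℂ p μ →L[ℂ] Lp ℂ p μ} (ha : IsHermitianElement a) (t : ℝ) (f : Lp ℂ p μ) :
    ∀ᵐ x ∂μ, ‖expI a t f x‖ = ‖f x‖ := by
  have key : ∀ (t : ℝ) (f : Lp ℂ p μ), ∀ᵐ x ∂μ, ‖expI a t f x‖ ≤ 1 * ‖f x‖ := fun t =>
    ae_norm_apply_le hp (fun hs => commute_expI (ha.commute_restrictLp hp hp2 hs) t) zero_le_one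
      fun f => by rw [one_mul, ha.norm_expI_apply]
  have h' : expI a (-t) (expI a t f) = f := DFunLike.congr_fun (expI_neg_mul a t) f
  have h2 := key (-t) (expI a t f)
  rw [h'] at h2
  filter_upwards [key t f, h2] with x h3 h4
  rw [one_mul] at h3 h4
  exact le_antisymm h3 h4

/-- Expand the squared norm and cancel one factor `t`; as `t → 0` the right side will vanish. -/
theorem two_mul_im_conj_mul_eq {z d : ℂ} {t : ℝ} (ht : t ≠ 0)
    (h : ‖z + Complex.I * t * d‖ = ‖z‖) :
    2 * ((starRingEnd ℂ) z * d).im = t * ‖d‖ ^ 2 := by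
  have h1 : ‖z + Complex.I * t * d‖ ^ 2 = ‖z‖ ^ 2 := by rw [h]
  rw [Complex.sq_norm, Complex.sq_norm, Complex.normSq_apply, Complex.normSq_apply] at h1
  rw [Complex.sq_norm, Complex.normSq_apply]
  simp at h1 ⊢
  refine mul_left_cancel₀ ht ?_
  linarith

theorem IsHermitianElement.ae_im_eq_zero (hp : p ≠ ∞) (hp2 : p ≠ 2)
    {a : Lp ℂ p μ →L[ℂ] Lp ℂ p μ} (ha : IsHermitianElement a) (f : Lp ℂ p μ) :
    ∀ᵐ x ∂μ, ((starRingEnd ℂ) (f x) * a f x).im = 0 := by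
  obtain ⟨t, d, ht, ht0, hd⟩ := exists_expI_expansion a f f
  have h0 : ∀ᵐ x ∂μ, ∀ n, ‖expI a (t n) f x‖ = ‖f x‖ :=
    ae_all_iff.2 fun n => ha.ae_norm_expI_apply hp hp2 (t n) f
  filter_upwards [hd, h0] with x ⟨h2, h3, _⟩ h5
  have h6 : Tendsto (fun n => 2 * ((starRingEnd ℂ) (f x) * d n x).im) atTop
      (𝓝 (2 * ((starRingEnd ℂ) (f x) * a f x).im)) :=
    ((Complex.continuous_im.tendsto _).comp (h3.const_mul _)).const_mul _
  have h7 := ht0.mul (h3.norm.pow 2)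
  rw [zero_mul] at h7
  have := tendsto_nhds_unique h6 (h7.congr fun n => (two_mul_im_conj_mul_eq (ht n) ?_).symm)
  · linarith
  · rw [← h2, h5]

/-- On any two functions, `a` is the multiplication by a common real function. -/
def IsLocallyRealMultiplication (a : Lp ℂ p μ →L[ℂ] Lp ℂ p μ) : Prop :=
  ∀ f g : Lp ℂ p μ, ∃ h : X → ℝ, ∀ᵐ x ∂μ, a f x = h x * f x ∧ a g x = h x * g x

theorem eq_re_div_mul {z w : ℂ} (hz : z ≠ 0) (h : ((starRingEnd ℂ) z * w).im = 0) :
    w = ((w / z).re : ℝ) * z := by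
  have : ((w / z).re : ℂ) = w / z := by
    refine Complex.ext rfl ?_
    have h1 : w / z = ((starRingEnd ℂ) z * w) / (Complex.normSq z : ℂ) := by
      rw [Complex.normSq_eq_conj_mul_self, mul_div_mul_left _ _ (by simpa using hz)]
    rw [Complex.ofReal_im, h1, Complex.div_ofReal_im, h, zero_div]
  rw [this, div_mul_cancel₀ _ hz]

theorem IsHermitianElement.isLocallyRealMultiplication (hp : p ≠ ∞) (hp2 : p ≠ 2)
    {a : Lp ℂ p μ →L[ℂ] Lp ℂ p μ} (ha : IsHermitianElement a) :
    IsLocallyRealMultiplication a := by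
  intro f g
  classical
  -- Where both functions vanish the value is immaterial, since `a f` and `a g` vanish there too.
  refine ⟨fun x => if f x = 0 then (a g x / g x).re else (a f x / f x).re, ?_⟩
  have hc := ae_mul_apply_comm hp (fun hs => ha.commute_restrictLp hp hp2 hs)
  have hz : ∀ f : Lp ℂ p μ, ∀ᵐ x ∂μ, f x = 0 → a f x = 0 := by
    intro f
    have hm : MeasurableSet {x | f x = 0} :=
      (Lp.stronglyMeasurable f).measurable (measurableSet_singleton 0)
    -- Taking `g` to be `a f` cut down to the zero set of `f` turns `f * a g = g * a f` into `0 = (a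
    -- f) ^ 2` on that set.
    filter_upwards [hc f (restrictLp μ p hm (a f)), coeFn_restrictLp hm (a f),
      coeFn_restrictLp hm f] with x h1 h2 h3 hx
    rw [h2, hx, zero_mul, Set.indicator_of_mem (by exact hx)] at h1
    exact mul_self_eq_zero.1 h1.symm
  filter_upwards [hc f g, hz f, hz g, ha.ae_im_eq_zero hp hp2 f, ha.ae_im_eq_zero hp hp2 g]
    with x h1 h2 h3 h4 h5
  by_cases hf : f x = 0
  · refine ⟨by rw [h2 hf, hf, mul_zero], ?_⟩
    by_cases hg : g x = 0
    · rw [h3 hg, hg, mul_zero]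
    · simpa only [hf, if_true] using eq_re_div_mul hg h5
  · simp only [hf, if_false]
    refine ⟨eq_re_div_mul hf h4, mul_left_cancel₀ hf ?_⟩
    rw [h1]
    conv_lhs => rw [eq_re_div_mul hf h4]
    ring

/-! ### Products and exponentials of local real multiplications -/

theorem IsLocallyRealMultiplication.mul {a b : Lp ℂ p μ →L[ℂ] Lp ℂ p μ}
    (ha : IsLocallyRealMultiplication a) (hb : IsLocallyRealMultiplication b) :
    IsLocallyRealMultiplication (a * b) := by
  intro f g
  obtain ⟨h, hh⟩ := hb f g
  obtain ⟨k, hk⟩ := ha (b f) (b g)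
  refine ⟨fun x => k x * h x, ?_⟩
  filter_upwards [hh, hk] with x h1 h2
  change a (b f) x = _ ∧ a (b g) x = _
  rw [h2.1, h2.2, h1.1, h1.2]
  push_cast
  exact ⟨by ring, by ring⟩

theorem IsLocallyRealMultiplication.exists_pow {a : Lp ℂ p μ →L[ℂ] Lp ℂ p μ}
    (ha : IsLocallyRealMultiplication a) (f : Lp ℂ p μ) :
    ∃ h : X → ℝ, ∀ᵐ x ∂μ, ∀ n : ℕ, (a ^ n) f x = (h x : ℂ) ^ n * f x := by
  obtain ⟨h, hh⟩ := ha f f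
  refine ⟨h, ae_all_iff.2 fun n => ?_⟩
  induction n with
  | zero => exact Eventually.of_forall fun x => by simp
  | succ n ih =>
    -- The multiplier `k` of this pair may differ from `h`, but `k * f = a f = h * f`, and `(a ^ n)
    -- f` is a multiple of `f`.
    obtain ⟨k, hk⟩ := ha f ((a ^ n) f)
    filter_upwards [hh, hk, ih] with x h1 h2 h3
    rw [pow_succ']
    change a ((a ^ n) f) x = _
    rw [h2.2, h3, pow_succ]
    have h4 := h2.1.symm.trans h1.1
    linear_combination (h x : ℂ) ^ n * h4

/-- Partial sums of the exponential series act on `f` as polynomials in `h`. A subsequence converges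
almost everywhere, which identifies `expI a t f` with a unimodular multiple of `f`. -/
theorem IsLocallyRealMultiplication.norm_expI_apply {a : Lp ℂ p μ →L[ℂ] Lp ℂ p μ}
    (ha : IsLocallyRealMultiplication a) (t : ℝ) (f : Lp ℂ p μ) : ‖expI a t f‖ = ‖f‖ := by
  obtain ⟨h, hh⟩ := ha.exists_pow f
  have hs := (NormedSpace.exp_series_hasSum_exp' (𝕂 := ℂ)
    ((Complex.I * (t : ℂ)) • a)).tendsto_sum_nat
  have hs' := ((ContinuousLinearMap.apply ℂ (Lp ℂ p μ) f).continuous.tendsto _).comp hs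
  obtain ⟨ns, hns, hx⟩ := exists_seq_tendsto_ae_Lp hs'
  have hsum : ∀ N : ℕ, ∀ᵐ x ∂μ, (∑ n ∈ Finset.range N,
      ((n.factorial : ℂ)⁻¹ • ((Complex.I * (t : ℂ)) • a) ^ n)) f x =
      (∑ n ∈ Finset.range N, ((n.factorial : ℂ)⁻¹ • (Complex.I * t * h x) ^ n)) * f x := by
    intro N
    induction N with
    | zero =>
      filter_upwards [Lp.coeFn_zero ℂ p μ] with x hx
      simpa using hx
    | succ N ih =>
      rw [Finset.sum_range_succ]
      filter_upwards [ih, hh, Lp.coeFn_add ((∑ n ∈ Finset.range N,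
        ((n.factorial : ℂ)⁻¹ • ((Complex.I * (t : ℂ)) • a) ^ n)) f)
        (((N.factorial : ℂ)⁻¹ • ((Complex.I * (t : ℂ)) • a) ^ N) f),
        Lp.coeFn_smul ((N.factorial : ℂ)⁻¹ * (Complex.I * t) ^ N) ((a ^ N) f)] with x h1 h2 h3 h4
      rw [add_apply, h3, Pi.add_apply, h1, smul_pow, smul_smul,
        smul_apply, h4, Pi.smul_apply, h2, Finset.sum_range_succ]
      simp only [smul_eq_mul]
      ring
  have hae : ∀ᵐ x ∂μ, expI a t f x = Complex.exp ((t * h x : ℝ) * Complex.I) * f x := by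
    filter_upwards [hx, ae_all_iff.2 hsum] with x h1 h2
    have h3 := (NormedSpace.exp_series_hasSum_exp' (𝕂 := ℂ)
      (Complex.I * t * h x)).tendsto_sum_nat.comp hns.tendsto_atTop
    rw [← Complex.exp_eq_exp_ℂ] at h3
    have h4 := tendsto_nhds_unique h1 ((h3.mul_const (f x)).congr fun n => (h2 (ns n)).symm)
    refine Eq.trans h4 ?_
    push_cast
    ring_nf
  refine le_antisymm (Lp.norm_le_norm_of_ae_le ?_) (Lp.norm_le_norm_of_ae_le ?_) <;>
  · filter_upwards [hae] with x hx
    rw [hx, norm_mul, Complex.norm_exp_ofReal_mul_I, one_mul]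

theorem IsLocallyRealMultiplication.isHermitianElement [Nontrivial (Lp ℂ p μ)]
    {a : Lp ℂ p μ →L[ℂ] Lp ℂ p μ} (ha : IsLocallyRealMultiplication a) :
    IsHermitianElement a := fun t =>
  ContinuousLinearMap.opNorm_eq_of_bounds zero_le_one
    (fun f => by rw [one_mul]; exact (ha.norm_expI_apply t f).le)
    fun N _ hN => by
      obtain ⟨f, hf⟩ := exists_ne (0 : Lp ℂ p μ)
      have h1 := hN f
      have h2 := ha.norm_expI_apply t f
      change ‖expI a t f‖ ≤ _ at h1
      rw [h2] at h1
      exact le_of_mul_le_mul_right (by rwa [one_mul]) (norm_pos_iff.2 hf)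

/-- On the zero space the exponential has norm `0`, not `1`. Hence the product statement needs no
assumption that `L^p` is nonzero. -/
theorem IsHermitianElement.nontrivial {E : Type*} [NormedAddCommGroup E] [NormedSpace ℂ E]
    {a : E →L[ℂ] E} (ha : IsHermitianElement a) : Nontrivial E := by
  by_contra h
  rw [not_nontrivial_iff_subsingleton] at h
  have h1 := ha 0
  rw [Subsingleton.elim (NormedSpace.exp _) (0 : E →L[ℂ] E), norm_zero] at h1
  exact zero_ne_one h1

theorem IsHermitianElement.mul_of_Lp (hp : p ≠ ∞) (hp2 : p ≠ 2)
    {a b : Lp ℂ p μ →L[ℂ] Lp ℂ p μ} (ha : IsHermitianElement a) (hb : IsHermitianElement b) :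
    IsHermitianElement (a * b) := by
  have := ha.nontrivial
  exact ((ha.isLocallyRealMultiplication hp hp2).mul
    (hb.isLocallyRealMultiplication hp hp2)).isHermitianElement

end Lp

/-! ### Localizable measures -/

section Lp

variable {X : Type*} [MeasurableSpace X] {μ : Measure X} {p : ℝ≥0∞}

theorem IsLocalizableMeasure.nontrivial_Lp (hμ : IsLocalizableMeasure μ) (h0 : μ ≠ 0) :
    Nontrivial (Lp ℂ p μ) := by
  obtain ⟨F, hF, hF0, hF1⟩ : ∃ F, MeasurableSet F ∧ 0 < μ F ∧ μ F < ∞ := by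
    by_cases h : μ Set.univ = ∞
    · obtain ⟨F, -, hF⟩ := hμ.semifinite _ MeasurableSet.univ h
      exact ⟨F, hF⟩
    · exact ⟨_, MeasurableSet.univ, Measure.measure_univ_pos.2 h0, lt_top_iff_ne_top.2 h⟩
  refine ⟨indicatorConstLp p hF hF1.ne (1 : ℂ), 0, fun h => hF0.ne' ?_⟩
  have h1 := indicatorConstLp_coeFn (p := p) (hs := hF) (hμs := hF1.ne) (c := (1 : ℂ))
  rw [h] at h1
  have h2 : ∀ᵐ x ∂μ, x ∉ F := by
    filter_upwards [h1, Lp.coeFn_zero ℂ p μ] with x hx hx' hxF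
    rw [hx', Set.indicator_of_mem hxF] at hx
    exact zero_ne_one hx
  simpa [ae_iff] using h2

variable [Fact (1 ≤ p)]

theorem IsLocallyRealMultiplication.commute_restrictLp {a : Lp ℂ p μ →L[ℂ] Lp ℂ p μ}
    (ha : IsLocallyRealMultiplication a) {s : Set X} (hs : MeasurableSet s) :
    Commute a (restrictLp μ p hs) := by
  refine ContinuousLinearMap.ext fun f => ?_
  change a (restrictLp μ p hs f) = restrictLp μ p hs (a f)
  obtain ⟨h, hh⟩ := ha f (restrictLp μ p hs f)
  ext1
  filter_upwards [hh, coeFn_restrictLp hs f, coeFn_restrictLp hs (a f)] with x h1 h2 h3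
  rw [h1.2, h2, h3]
  by_cases hx : x ∈ s <;> simp [hx, h1.1]

/-- Recovers a function from its rational superlevel sets. Clamping, with default `-C`, keeps the
supremum bounded at every point, even where the sets are inconsistent. -/
theorem iSup_rat_clamp_eq {C r : ℝ} (hr : |r| ≤ C) (P : ℚ → Prop) [DecidablePred P]
    (hP : ∀ q : ℚ, P q ↔ (q : ℝ) < r) :
    ⨆ q : ℚ, (if P q then max (-C) (min (q : ℝ) C) else -C) = r := by
  have hr' := abs_le.1 hr
  have hle : ∀ q : ℚ, (if P q then max (-C) (min (q : ℝ) C) else -C) ≤ r := by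
    intro q
    split_ifs with h
    · exact max_le hr'.1 ((min_le_left _ _).trans ((hP q).1 h).le)
    · exact hr'.1
  refine le_antisymm (ciSup_le hle) (le_of_forall_lt fun c hc => ?_)
  obtain ⟨q, hq, hq'⟩ := exists_rat_btwn hc
  refine hq.trans_le (le_trans ?_ (le_ciSup ⟨r, Set.forall_mem_range.2 hle⟩ q))
  rw [if_pos ((hP q).2 hq')]
  exact (le_min le_rfl (hq'.le.trans hr'.2)).trans (le_max_right _ _)

/-- A family of real functions on the sets of finite measure that agree on overlaps is glued
together by a measurable function, if the measure is localizable. -/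
theorem IsLocalizableMeasure.exists_glue (hμ : IsLocalizableMeasure μ) {C : ℝ} (hC : 0 ≤ C)
    (F : ∀ E : Set X, MeasurableSet E → μ E ≠ ∞ → X → ℝ)
    (hF : ∀ E hE hE', Measurable (F E hE hE'))
    (hFC : ∀ E hE hE', ∀ᵐ x ∂μ, |F E hE hE' x| ≤ C)
    (hFF : ∀ E hE hE' G hG hG', ∀ᵐ x ∂μ, x ∈ E → x ∈ G → F E hE hE' x = F G hG hG' x) :
    ∃ h : X → ℝ, Measurable h ∧ (∀ x, |h x| ≤ C) ∧
      ∀ E hE hE', ∀ᵐ x ∂μ, x ∈ E → h x = F E hE hE' x := by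
  classical
  -- `H q` is to be the superlevel set `{q < h}` of the glued function, up to null sets on each `E`.
  have hess := fun q : ℚ => hμ.exists_essSup
    {s | ∃ E hE hE', s = E ∩ {x | (q : ℝ) < F E hE hE' x}} (by
      rintro _ ⟨E, hE, hE', rfl⟩
      exact hE.inter (measurableSet_lt measurable_const (hF E hE hE')))
  choose H hH hHup hHleast using hess
  have hle : ∀ x (q : ℚ), (if x ∈ H q then max (-C) (min (q : ℝ) C) else -C) ≤ C := by
    intro x q
    split_ifs
    · exact max_le (by linarith) (min_le_right _ _)
    · linarith
  have hge : ∀ x (q : ℚ), -C ≤ (if x ∈ H q then max (-C) (min (q : ℝ) C) else -C) := by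
    intro x q
    split_ifs
    · exact le_max_left _ _
    · exact le_rfl
  refine ⟨fun x => ⨆ q : ℚ, (if x ∈ H q then max (-C) (min (q : ℝ) C) else -C),
    Measurable.iSup fun q => Measurable.ite (hH q) measurable_const measurable_const,
    fun x => abs_le.2 ⟨(hge x 0).trans (le_ciSup ⟨C, Set.forall_mem_range.2 (hle x)⟩ 0),
      ciSup_le (hle x)⟩, fun E hE hE' => ?_⟩
  have hiff : ∀ q : ℚ, ∀ᵐ x ∂μ, x ∈ E → (x ∈ H q ↔ (q : ℝ) < F E hE hE' x) := by
    intro q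
    have h1 : ∀ᵐ x ∂μ, x ∉ (E ∩ {x | (q : ℝ) < F E hE hE' x}) \ H q :=
      measure_eq_zero_iff_ae_notMem.1 (hHup q _ ⟨E, hE, hE', rfl⟩)
    -- Removing from `H q` the points of `E` with `F E ≤ q` leaves an essential upper bound, by
    -- agreement on overlaps; minimality of `H q` makes the removed part null.
    have h2 : ∀ᵐ x ∂μ, x ∉ H q \ (H q \ (E ∩ {x | F E hE hE' x ≤ q})) := by
      refine measure_eq_zero_iff_ae_notMem.1 (hHleast q _ ((hH q).diff
        (hE.inter (measurableSet_le (hF E hE hE') measurable_const))) ?_)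
      rintro _ ⟨G, hG, hG', rfl⟩
      have h3 : ∀ᵐ x ∂μ, x ∉ (G ∩ {x | (q : ℝ) < F G hG hG' x}) \ H q :=
        measure_eq_zero_iff_ae_notMem.1 (hHup q _ ⟨G, hG, hG', rfl⟩)
      refine measure_eq_zero_iff_ae_notMem.2 ?_
      filter_upwards [h3, hFF E hE hE' G hG hG'] with x h4 h5 h6
      refine h6.2 ⟨by_contra fun h7 => h4 ⟨h6.1, h7⟩, fun h8 => ?_⟩
      have h9 : F E hE hE' x ≤ q := h8.2
      rw [h5 h8.1 h6.1.1] at h9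
      exact h9.not_gt h6.1.2
    filter_upwards [h1, h2] with x h3 h4 hx
    exact ⟨fun h5 => not_le.1 fun h6 => h4 ⟨h5, fun h7 => h7.2 ⟨hx, h6⟩⟩,
      fun h5 => by_contra fun h6 => h3 ⟨⟨hx, h5⟩, h6⟩⟩
  filter_upwards [ae_all_iff.2 hiff, hFC E hE hE'] with x h1 h2 hx
  exact iSup_rat_clamp_eq h2 _ fun q => h1 q hx

theorem IsLocallyRealMultiplication.exists_isMultiplicationBy (hp : p ≠ ∞)
    (hμ : IsLocalizableMeasure μ) {a : Lp ℂ p μ →L[ℂ] Lp ℂ p μ}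
    (ha : IsLocallyRealMultiplication a) : ∃ h : Lp ℝ ∞ μ, IsMultiplicationBy a h := by
  have hb := ae_norm_apply_le hp (fun hs => ha.commute_restrictLp hs) (norm_nonneg a)
    a.le_opNorm
  obtain ⟨h, hm, hC, hh⟩ := hμ.exists_glue (norm_nonneg a)
    (fun E hE hE' x => (a (indicatorConstLp p hE hE' (1 : ℂ)) x).re)
    (fun E hE hE' => Complex.measurable_re.comp (Lp.stronglyMeasurable _).measurable)
    (fun E hE hE' => by
      filter_upwards [hb (indicatorConstLp p hE hE' (1 : ℂ)),
        indicatorConstLp_coeFn (p := p) (hs := hE) (hμs := hE') (c := (1 : ℂ))] with x h1 h2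
      refine (Complex.abs_re_le_norm _).trans (h1.trans ?_)
      rw [h2]
      refine mul_le_of_le_one_right (norm_nonneg a) ((norm_indicator_le_norm_self _ _).trans ?_)
      simp)
    (fun E hE hE' G hG hG' => by
      obtain ⟨k, hk⟩ := ha (indicatorConstLp p hE hE' (1 : ℂ)) (indicatorConstLp p hG hG' (1 : ℂ))
      filter_upwards [hk, indicatorConstLp_coeFn (p := p) (hs := hE) (hμs := hE') (c := (1 : ℂ)),
        indicatorConstLp_coeFn (p := p) (hs := hG) (hμs := hG') (c := (1 : ℂ))]
        with x h1 h2 h3 hxE hxG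
      rw [h1.1, h1.2, h2, h3, Set.indicator_of_mem hxE, Set.indicator_of_mem hxG])
  have hmem : MemLp h ∞ μ :=
    memLp_top_of_bound hm.aestronglyMeasurable ‖a‖ (Eventually.of_forall hC)
  refine ⟨hmem.toLp h, fun f => ?_⟩
  -- These sets have finite measure and exhaust the support of `f`, so the glued multiplier, known
  -- only on sets of finite measure, suffices.
  have hE : ∀ n : ℕ, MeasurableSet {x | 1 / ((n : ℝ) + 1) ≤ ‖f x‖} := fun n =>
    measurableSet_le measurable_const (Lp.stronglyMeasurable f).measurable.norm
  have hE' : ∀ n : ℕ, μ {x | 1 / ((n : ℝ) + 1) ≤ ‖f x‖} ≠ ∞ := fun n => by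
    have hn : (0 : ℝ) ≤ 1 / ((n : ℝ) + 1) := by positivity
    have := (Lp.memLp f).meas_ge_lt_top (zero_lt_one.trans_le Fact.out).ne' hp
      (ε := ⟨1 / ((n : ℝ) + 1), hn⟩) (fun h => by
        have : (1 : ℝ) / ((n : ℝ) + 1) = 0 := congrArg NNReal.toReal h
        exact absurd this (by positivity))
    exact this.ne
  have hn : ∀ n : ℕ, ∀ᵐ x ∂μ, 1 / ((n : ℝ) + 1) ≤ ‖f x‖ → a f x = h x * f x := by
    intro n
    obtain ⟨k, hk⟩ := ha f (indicatorConstLp p (hE n) (hE' n) (1 : ℂ))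
    filter_upwards [hk, hh _ (hE n) (hE' n),
      indicatorConstLp_coeFn (p := p) (hs := hE n) (hμs := hE' n) (c := (1 : ℂ))]
      with x h1 h2 h3 hx
    rw [h2 hx, h1.2, h3, Set.indicator_of_mem (by exact hx), h1.1]
    simp
  obtain ⟨k, hk⟩ := ha f f
  filter_upwards [ae_all_iff.2 hn, hk, hmem.coeFn_toLp] with x h1 h2 h3
  rw [h3]
  by_cases hx : f x = 0
  · rw [h2.1, hx, mul_zero, mul_zero]
  · obtain ⟨n, hn⟩ := exists_nat_one_div_lt (norm_pos_iff.2 hx)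
    exact h1 n hn.le

theorem IsMultiplicationBy.isLocallyRealMultiplication {a : Lp ℂ p μ →L[ℂ] Lp ℂ p μ}
    {h : Lp ℝ ∞ μ} (ha : IsMultiplicationBy a h) : IsLocallyRealMultiplication a := fun f g =>
  ⟨h, (ha f).and (ha g)⟩

theorem IsLocalizableMeasure.isHermitianElement_iff (hp : p ≠ ∞) (hp2 : p ≠ 2)
    (hμ : IsLocalizableMeasure μ) (h0 : μ ≠ 0) (a : Lp ℂ p μ →L[ℂ] Lp ℂ p μ) :
    IsHermitianElement a ↔ ∃ h : Lp ℝ ∞ μ, IsMultiplicationBy a h := by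
  have := hμ.nontrivial_Lp (p := p) h0
  exact ⟨fun ha => (ha.isLocallyRealMultiplication hp hp2).exists_isMultiplicationBy hp hμ,
    fun ⟨h, hh⟩ => hh.isLocallyRealMultiplication.isHermitianElement⟩

end Lp

/-! ### The Stone space of a localizable measure algebra -/

namespace MeasureAlgebra

open StoneSpace

variable {𝔄 : Type*} [BooleanAlgebra 𝔄]

theorem stoneMeasure_clopen_diff_eq_zero_iff (M : MeasureAlgebra 𝔄) (a b : 𝔄) :
    M.stoneMeasure (clopen a \ clopen b) = 0 ↔ a ≤ b := by
  rw [Set.sdiff_eq, ← clopen_compl, ← clopen_inf, stoneMeasure_clopen, M.measure_eq_zero_iff,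
    ← disjoint_iff, disjoint_compl_right_iff]

/-- Modulo null sets, measurable sets are elements of `𝔄`, and inclusion is the order of `𝔄`;
essential suprema are therefore suprema in `𝔄`. -/
theorem IsLocalizable.isLocalizableMeasure {M : MeasureAlgebra 𝔄} (hM : M.IsLocalizable) :
    IsLocalizableMeasure M.stoneMeasure := by
  have hcl : ∀ E : Set (StoneSpace 𝔄), ∃ a : 𝔄, MeasurableSet E →
      E =ᵐ[M.stoneMeasure] clopen a := fun E => by
    by_cases hE : MeasurableSet E
    · exact (M.existsUnique_ae_eq_clopen hE).exists.imp fun _ h _ => h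
    · exact ⟨⊥, fun h => (hE h).elim⟩
  choose e he using hcl
  have hdiff : ∀ E G : Set (StoneSpace 𝔄), MeasurableSet E → MeasurableSet G →
      (M.stoneMeasure (E \ G) = 0 ↔ e E ≤ e G) := fun E G hE hG => by
    rw [← M.stoneMeasure_clopen_diff_eq_zero_iff, measure_congr ((he E hE).diff (he G hG))]
  refine ⟨fun E hE hE' => ?_, fun S hS => ?_⟩
  · rw [measure_congr (he E hE), stoneMeasure_clopen] at hE'
    obtain ⟨b, hb, hb0, hbt⟩ := hM.semifinite _ hE'
    have h1 : M.stoneMeasure (E ∩ clopen b) = M.measure b := by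
      rw [measure_congr ((he E hE).inter (EventuallyEq.refl _ (clopen b))), ← clopen_inf,
        stoneMeasure_clopen, inf_eq_right.2 hb]
    refine ⟨E ∩ clopen b, Set.inter_subset_left, hE.inter (measurableSet_clopen b), ?_, ?_⟩
    · rw [h1, pos_iff_ne_zero]
      exact fun h => hb0 ((M.measure_eq_zero_iff b).1 h)
    · rwa [h1]
  · obtain ⟨s, hs⟩ := hM.complete (e '' S)
    refine ⟨clopen s, measurableSet_clopen s, fun E hE => ?_, fun G hG h => ?_⟩
    · rw [measure_congr ((he E (hS E hE)).diff (EventuallyEq.refl _ (clopen s))),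
        stoneMeasure_clopen_diff_eq_zero_iff]
      exact hs.1 ⟨E, hE, rfl⟩
    · rw [measure_congr ((EventuallyEq.refl _ (clopen s)).diff (he G hG)),
        stoneMeasure_clopen_diff_eq_zero_iff]
      refine hs.2 ?_
      rintro _ ⟨E, hE, rfl⟩
      exact (hdiff E G (hS E hE) hG).1 (h E hE)

theorem stoneMeasure_ne_zero [Nontrivial 𝔄] (M : MeasureAlgebra 𝔄) : M.stoneMeasure ≠ 0 := by
  intro h
  have h1 := M.stoneMeasure_clopen ⊤
  rw [h, Measure.coe_zero, Pi.zero_apply] at h1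
  exact top_ne_bot ((M.measure_eq_zero_iff ⊤).1 h1.symm)

end MeasureAlgebra

theorem mainTheorem9 (p : ℝ≥0∞) [Fact (1 ≤ p)] (hp : p ≠ ∞) (hp2 : p ≠ 2) :
    -- hermitian operators on the `L^p`-space of a nonzero localizable measure algebra
    (∀ (𝔄 : Type u) [BooleanAlgebra 𝔄] [Nontrivial 𝔄] (M : MeasureAlgebra 𝔄), M.IsLocalizable →
      ∀ a : M.Lp p →L[ℂ] M.Lp p,
        IsHermitianElement a ↔ ∃ h : M.LinftyReal, IsMultiplicationBy a h) ∧
    -- the same on the `L^p`-space of a nonzero localizable measure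
    (∀ (X : Type v) [MeasurableSpace X] (μ : Measure X), μ ≠ 0 → IsLocalizableMeasure μ →
      ∀ a : Lp ℂ p μ →L[ℂ] Lp ℂ p μ,
        IsHermitianElement a ↔ ∃ h : Lp ℝ ∞ μ, IsMultiplicationBy a h) ∧
    -- on the `L^p`-space of any measure, hermitian operators are closed under multiplication
    (∀ (X : Type v) [MeasurableSpace X] (μ : Measure X) (a b : Lp ℂ p μ →L[ℂ] Lp ℂ p μ),
      IsHermitianElement a → IsHermitianElement b → IsHermitianElement (a * b)) :=
  ⟨fun _ _ _ M hM a => hM.isLocalizableMeasure.isHermitianElement_iff hp hp2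
      M.stoneMeasure_ne_zero a,
    fun _ _ _ h0 hμ a => hμ.isHermitianElement_iff hp hp2 h0 a,
    fun _ _ _ _ _ ha hb => ha.mul_of_Lp hp hp2 hb⟩
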